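/- Let $(\Pi,\rho)$ be a probability space and, for $N\ge 2$, let $\hat{\mathcal P}_N(\Pi)=\{\frac1{N-1}\sum_{k=1}^{N-1}\delta_{y_k}: y_1,\dots,y_{N-1}\in\Pi\}$ be the set of empirical measures of $N-1$ particles. For $\boldsymbol y=(y_1,\dots,y_{N-1})\in\Pi^{N-1}$ write $\mu(\boldsymbol y)=\frac1{N-1}\sum_{k=1}^{N-1}\delta_{y_k}$, and for $\boldsymbol x\in\Pi^N$ let $\boldsymbol x_{-k}\in\Pi^{N-1}$ be $\boldsymbol x$ with its $k$-th coordinate removed. There is a universal constant $b>0$ (independent of $N$, $(\Pi,\rho)$, $C$ and $\Phi$) such that the following holds. Let $N\ge2$, $C\ge0$, and let $\Phi:\Pi\times\hat{\mathcal P}_N(\Pi)\to\mathbb R$ be such that $(x,\boldsymbol y)\mapsto\Phi(x,\mu(\boldsymbol y))$ is measurable on $\Pi\times\Pi^{N-1}$ and: 1. $|\Phi(x,\mu)-\Phi(x',\mu)|\le C$ for all $\mu\in\hat{\mathcal P}_N(\Pi)$ and $x,x'\in\Pi$. 2. $\int_\Pi\Phi(x,\mu)\,d\rho(x)=0$ for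 all $\mu\in\hat{\mathcal P}_N(\Pi)$. 3. $|\Phi(z,\sigma+\frac1{N-1}\delta_{x_1})-\Phi(z,\sigma+\frac1{N-1}\delta_{x_1'})|\le\frac{C}{N-1}$ for all $z,x_1,x_1'\in\Pi$ and all $\sigma=\frac1{N-1}\sum_{k=1}^{N-2}\delta_{y_k}$ with $y_1,\dots,y_{N-2}\in\Pi$. 4. If $N\ge3$, then for all $z,x_1,x_1',x_2,x_2'\in\Pi$ and all $\sigma=\frac1{N-1}\sum_{k=1}^{N-3}\delta_{y_k}$ with $y_1,\dots,y_{N-3}\in\Pi$, writing $\mu=\sigma+\frac1{N-1}(\delta_{x_1}+\delta_{x_2})$, $\mu^{(1)}=\sigma+\frac1{N-1}(\delta_{x_1'}+\delta_{x_2})$, $\mu^{(2)}=\sigma+\frac1{N-1}(\delta_{x_1}+\delta_{x_2'})$, $\mu^{(1,2)}=\sigma+\frac1{N-1}(\delta_{x_1'}+\delta_{x_2'})$, one has $$|\Phi(z,\mu)-\Phi(z,\mu^{(1)})-\Phi(z,\mu^{(2)})+\Phi(z,\mu^{(1,2)})|\le\frac{C}{(N-1)(N-2)}.$$ Set $\bar\Phi(x)=\int_{\Pi^{N-1}}\Phi(x,\mu(\boldsymbol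 y))\,d\rho^{\otimes(N-1)}(\boldsymbol y)$ and $F_\Phi(\boldsymbol x)=\sum_{k=1}^N[\Phi(x_k,\mu(\boldsymbol x_{-k}))-\bar\Phi(x_k)]$ for $\boldsymbol x\in\Pi^N$. If $C>0$, then $$\int_{\Pi^N}\exp\Bigl(\frac bC\,|F_\Phi(\boldsymbol x)|\Bigr)\,d\rho^{\otimes N}(\boldsymbol x)\le2,$$ and if $C=0$, then $F_\Phi=0$ identically on $\Pi^N$. -/

import Mathlib

open MeasureTheory
open scoped ENNReal

universe u

namespace MeanField

/-- The empirical measure `μ(y) = (1/n) ∑ k, δ_{y_k}` of a configuration of `n` particles.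
It is a probability measure for `n ≥ 1` (and the zero measure for `n = 0`, which is never used). -/
noncomputable def empiricalMeasure {X : Type*} [MeasurableSpace X] {n : ℕ} (y : Fin n → X) :
    Measure X :=
  (n : ℝ≥0∞)⁻¹ • ∑ k, Measure.dirac (y k)

/-- The set of all empirical measures of `N - 1` particles in `X` (for `N ≥ 2`). The subscript `N`
refers to measures of `N - 1` particles. -/
def EmpiricalMeasures (N : ℕ) (X : Type*) [MeasurableSpace X] : Set (Measure X) :=
  Set.range fun y : Fin (N - 1) → X => empiricalMeasure y

/-- The empirical measure operator on `N - 1` particles, as a map into `EmpiricalMeasures N X`. -/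
noncomputable def emp {N : ℕ} {X : Type*} [MeasurableSpace X] (y : Fin (N - 1) → X) :
    EmpiricalMeasures N X :=
  ⟨empiricalMeasure y, y, rfl⟩

/-- The truncated configuration `x_{-k}`: the `k`-th particle is removed from `x`. -/
def truncate {X : Type*} : {N : ℕ} → Fin N → (Fin N → X) → (Fin (N - 1) → X)
  | 0, k, _ => k.elim0
  | _ + 1, k, x => fun j => x (k.succAbove j)

/-- `σ` is formed by `m` particles, each carrying the mass `1 / (N - 1)`. -/
def IsFormedBy {X : Type*} [MeasurableSpace X] (N m : ℕ) (σ : Measure X) : Prop :=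
  ∃ y : Fin m → X, σ = ((N - 1 : ℕ) : ℝ≥0∞)⁻¹ • ∑ k, Measure.dirac (y k)

/-- The four conditions on `Φ : X × EmpiricalMeasures N X → ℝ`, with the constant `C`. -/
structure BoundedDifferences {X : Type*} [MeasurableSpace X] (ρ : Measure X) (N : ℕ) (C : ℝ)
    (Φ : X → EmpiricalMeasures N X → ℝ) : Prop where
  /-- Bounded difference in the first argument. -/
  bounded_fst : ∀ (μ : EmpiricalMeasures N X) (x x' : X), |Φ x μ - Φ x' μ| ≤ C
  /-- Centered in `x`. -/
  centered : ∀ μ : EmpiricalMeasures N X, ∫ x, Φ x μ ∂ρ = 0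
  /-- First-order bounded difference in measures; `σ` is formed by `N - 2` particles. -/
  first_order : ∀ (z x₁ x₁' : X) (σ : Measure X), IsFormedBy N (N - 2) σ →
    ∀ μ μ₁ : EmpiricalMeasures N X,
      (μ : Measure X) = σ + ((N - 1 : ℕ) : ℝ≥0∞)⁻¹ • Measure.dirac x₁ →
      (μ₁ : Measure X) = σ + ((N - 1 : ℕ) : ℝ≥0∞)⁻¹ • Measure.dirac x₁' →
      |Φ z μ - Φ z μ₁| ≤ C / ((N : ℝ) - 1)
  /-- Second-order bounded difference in measures; `σ` is formed by `N - 3` particles. There is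
  no such configuration, and hence no condition, if `N = 2`. -/
  second_order : 3 ≤ N → ∀ (z x₁ x₁' x₂ x₂' : X) (σ : Measure X), IsFormedBy N (N - 3) σ →
    ∀ μ μ₁ μ₂ μ₁₂ : EmpiricalMeasures N X,
      (μ : Measure X) =
        σ + ((N - 1 : ℕ) : ℝ≥0∞)⁻¹ • (Measure.dirac x₁ + Measure.dirac x₂) →
      (μ₁ : Measure X) =
        σ + ((N - 1 : ℕ) : ℝ≥0∞)⁻¹ • (Measure.dirac x₁' + Measure.dirac x₂) →
      (μ₂ : Measure X) =
        σ + ((N - 1 : ℕ) : ℝ≥0∞)⁻¹ • (Measure.dirac x₁ + Measure.dirac x₂') →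
      (μ₁₂ : Measure X) =
        σ + ((N - 1 : ℕ) : ℝ≥0∞)⁻¹ • (Measure.dirac x₁' + Measure.dirac x₂') →
      |Φ z μ - Φ z μ₁ - Φ z μ₂ + Φ z μ₁₂| ≤ C / (((N : ℝ) - 1) * ((N : ℝ) - 2))

/-- The compensator: the average of `Φ(x, μ(y))` over `y` distributed as `ρ^{⊗(N-1)}`. -/
noncomputable def compensator {X : Type*} [MeasurableSpace X] (ρ : Measure X) {N : ℕ}
    (Φ : X → EmpiricalMeasures N X → ℝ) (x : X) : ℝ :=
  ∫ y : Fin (N - 1) → X, Φ x (emp y) ∂(Measure.pi fun _ => ρ)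

/-- `F_Φ(x) = ∑ k, [Φ(x_k, μ(x_{-k})) - compensator(x_k)]`. -/
noncomputable def fluctuation {X : Type*} [MeasurableSpace X] (ρ : Measure X) {N : ℕ}
    (Φ : X → EmpiricalMeasures N X → ℝ) (x : Fin N → X) : ℝ :=
  ∑ k, (Φ (x k) (emp (truncate k x)) - compensator ρ Φ (x k))

end MeanField

/-! Write `N = n + 2`. The function `F_Φ` is doubly degenerate: centring in the first argument and
subtracting the compensator make its mean vanish, and also its conditional mean given any one
coordinate. Its mixed second differences are of order `C / N`: for coordinates `i ≠ j`, the terms `k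
= i, j` contribute first differences of order `C / N`, and each of the others a second difference of
order `C / N²`. Such a function behaves like a second-order chaos, sub-exponential at scale `N * (C
/ N) = C`; this is `integral_exp_abs_div_le_two`.

Averaging the coordinates of such an `f` out one at a time writes it as a sum of martingale
differences `d_i`. Let `v_i` be `d_i ^ 2` plus its conditional mean. A self-normalized bound holds
with no smallness condition on `l`: `exp (l f - l² ∑ v_i)` has integral at most 1
(`exists_quadratic_variation`). It remains to control `∑ v_i`. With its own coordinate frozen, `d_i`
is centred, by degeneracy, and has bounded differences, since these are averages of mixed
differences of `f`. Hence `d_i` is sub-Gaussian (`integral_exp_sq_div_le`) and `v_i` is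
exponentially integrable at scale `N c²`. -/

namespace MeanField

/-- Bounded measurable real functions. -/
def BddMeas {α : Type*} [MeasurableSpace α] (f : α → ℝ) : Prop :=
  Measurable f ∧ ∃ B, ∀ x, |f x| ≤ B

theorem abs_integral_le {α : Type*} [MeasurableSpace α] {ν : Measure α} [IsProbabilityMeasure ν]
    {f : α → ℝ} {c : ℝ} (h : ∀ x, |f x| ≤ c) : |∫ x, f x ∂ν| ≤ c := by
  simpa using norm_integral_le_of_norm_le_const (μ := ν) (f := f) (ae_of_all _ h)

/-! ### Closure properties that make every integrand below integrable. -/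

namespace BddMeas

variable {α β : Type*} [MeasurableSpace α] [MeasurableSpace β] {f g : α → ℝ}

theorem integrable (hf : BddMeas f) (μ : Measure α) [IsFiniteMeasure μ] : Integrable f μ := by
  obtain ⟨hm, B, hB⟩ := hf
  exact Integrable.of_bound hm.aestronglyMeasurable B (ae_of_all _ hB)

theorem comp_measurable (hf : BddMeas f) {φ : β → α} (hφ : Measurable φ) :
    BddMeas fun x => f (φ x) :=
  ⟨hf.1.comp hφ, hf.2.imp fun _ h x => h (φ x)⟩

theorem continuous_comp (hf : BddMeas f) {F : ℝ → ℝ} (hF : Continuous F) :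
    BddMeas fun x => F (f x) := by
  obtain ⟨hm, B, hB⟩ := hf
  obtain ⟨K, hK⟩ := (isCompact_Icc (a := -B) (b := B)).exists_bound_of_continuousOn hF.continuousOn
  exact ⟨hF.measurable.comp hm, K, fun x => hK _ (abs_le.1 (hB x))⟩

theorem const (c : ℝ) : BddMeas fun _ : α => c := ⟨measurable_const, |c|, fun _ => le_rfl⟩

theorem add (hf : BddMeas f) (hg : BddMeas g) : BddMeas fun x => f x + g x := by
  obtain ⟨hm, B, hB⟩ := hf
  obtain ⟨hm', B', hB'⟩ := hg
  exact ⟨hm.add hm', B + B', fun x => (abs_add_le _ _).trans (add_le_add (hB x) (hB' x))⟩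

theorem const_mul (hf : BddMeas f) (c : ℝ) : BddMeas fun x => c * f x :=
  hf.continuous_comp (continuous_const_mul c)

theorem sub (hf : BddMeas f) (hg : BddMeas g) : BddMeas fun x => f x - g x := by
  simpa [sub_eq_add_neg] using hf.add (hg.const_mul (-1))

theorem sq (hf : BddMeas f) : BddMeas fun x => f x ^ 2 := hf.continuous_comp (continuous_pow 2)

theorem exp (hf : BddMeas f) : BddMeas fun x => Real.exp (f x) :=
  hf.continuous_comp Real.continuous_exp

theorem sum {ι : Type*} (s : Finset ι) {f : ι → α → ℝ} (hf : ∀ i, BddMeas (f i)) :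
    BddMeas fun x => ∑ i ∈ s, f i x := by
  classical
  induction s using Finset.induction_on with
  | empty => simpa using const (α := α) 0
  | insert a s ha ih => simpa [Finset.sum_insert ha] using (hf a).add ih

theorem integral_right {G : α × β → ℝ} (hG : BddMeas G) (ν : Measure β) [IsProbabilityMeasure ν] :
    BddMeas fun x => ∫ y, G (x, y) ∂ν := by
  obtain ⟨hm, B, hB⟩ := hG
  exact ⟨(hm.stronglyMeasurable.integral_prod_right' (ν := ν)).measurable, B,
    fun x => abs_integral_le fun y => hB (x, y)⟩

end BddMeas

/-- Invert `exp (x² - x) ≥ 1 - x + x² > 0` and use `(1 + x + x²)(1 - x + x²) = 1 + x² + x⁴ ≥ 1`. The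
bound holds for all real `x`, so no smallness of the increments is needed later. -/
theorem exp_sub_sq_le (x : ℝ) : Real.exp (x - x ^ 2) ≤ 1 + x + x ^ 2 := by
  have h1 : 0 < 1 - x + x ^ 2 := by nlinarith [sq_nonneg (x - 1)]
  have h2 : 1 - x + x ^ 2 ≤ Real.exp (x ^ 2 - x) := by
    linarith [Real.add_one_le_exp (x ^ 2 - x)]
  have h3 : Real.exp (x - x ^ 2) * Real.exp (x ^ 2 - x) = 1 := by
    rw [← Real.exp_add]; simp
  have h4 : Real.exp (x - x ^ 2) * (1 - x + x ^ 2) ≤ 1 :=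
    (mul_le_mul_of_nonneg_left h2 (Real.exp_pos _).le).trans h3.le
  have h5 : 1 ≤ (1 + x + x ^ 2) * (1 - x + x ^ 2) := by nlinarith [sq_nonneg x, sq_nonneg (x ^ 2)]
  exact le_of_mul_le_mul_right (h4.trans h5) h1

/-! ### Exponential moments of one centred variable. -/

section OneVariable

variable {α : Type*} [MeasurableSpace α] {ν : Measure α} [IsProbabilityMeasure ν] {d : α → ℝ}

theorem integral_exp_sub_sq_le (hd : BddMeas d) (h0 : ∫ t, d t ∂ν = 0) :
    ∫ t, Real.exp (d t - d t ^ 2) ∂ν ≤ Real.exp (∫ t, d t ^ 2 ∂ν) := by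
  calc ∫ t, Real.exp (d t - d t ^ 2) ∂ν ≤ ∫ t, (1 + d t + d t ^ 2) ∂ν :=
        integral_mono ((hd.sub hd.sq).exp.integrable ν)
          ((((BddMeas.const 1).add hd).add hd.sq).integrable ν) fun t => exp_sub_sq_le _
    _ = 1 + ∫ t, d t ^ 2 ∂ν := by
        rw [integral_add (((BddMeas.const 1).add hd).integrable ν) (hd.sq.integrable ν),
          integral_add ((BddMeas.const 1).integrable ν) (hd.integrable ν), h0]
        simp
    _ ≤ _ := by linarith [Real.add_one_le_exp (∫ t, d t ^ 2 ∂ν)]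

theorem integral_exp_mul_le (hd : BddMeas d) (h0 : ∫ t, d t ∂ν = 0) {c : ℝ}
    (hc : ∀ t, |d t| ≤ c) (y : ℝ) :
    ∫ t, Real.exp (y * d t) ∂ν ≤ Real.exp (2 * y ^ 2 * c ^ 2) := by
  have hyd := hd.const_mul y
  have hsq : ∀ t, (y * d t) ^ 2 ≤ y ^ 2 * c ^ 2 := fun t => by
    rw [mul_pow, ← sq_abs (d t)]
    have := hc t
    gcongr
  have h1 := integral_exp_sub_sq_le (ν := ν) hyd (by rw [integral_const_mul, h0, mul_zero])
  have h2 : ∫ t, (y * d t) ^ 2 ∂ν ≤ y ^ 2 * c ^ 2 := by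
    simpa using integral_mono (hyd.sq.integrable ν) (integrable_const (y ^ 2 * c ^ 2)) hsq
  calc ∫ t, Real.exp (y * d t) ∂ν
      ≤ ∫ t, Real.exp (y ^ 2 * c ^ 2) * Real.exp (y * d t - (y * d t) ^ 2) ∂ν := by
        refine integral_mono (hyd.exp.integrable ν)
          (((hyd.sub hyd.sq).exp.const_mul _).integrable ν) fun t => ?_
        simp only [← Real.exp_add]
        exact Real.exp_le_exp.2 (by linarith [hsq t])
    _ = Real.exp (y ^ 2 * c ^ 2) * ∫ t, Real.exp (y * d t - (y * d t) ^ 2) ∂ν :=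
        integral_const_mul _ _
    _ ≤ Real.exp (y ^ 2 * c ^ 2) * Real.exp (y ^ 2 * c ^ 2) := by
        gcongr
        exact h1.trans (Real.exp_le_exp.2 h2)
    _ = _ := by rw [← Real.exp_add]; ring_nf

end OneVariable

/-! ### Averaging out one coordinate, and sub-Gaussian concentration. -/

section Product

variable {X : Type*} [MeasurableSpace X] {ρ : Measure X} [IsProbabilityMeasure ρ]

theorem measurable_cons {n : ℕ} :
    Measurable fun p : (Fin n → X) × X => (Fin.cons p.2 p.1 : Fin (n + 1) → X) := by
  refine measurable_pi_lambda _ fun i => ?_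
  refine Fin.cases ?_ (fun j => ?_) i
  · simpa using measurable_snd
  · exact (measurable_pi_apply j).comp measurable_fst

theorem measurePreserving_apply_succAbove {n : ℕ} (k : Fin (n + 1)) :
    MeasurePreserving (fun x : Fin (n + 1) → X => (x k, fun j => x (k.succAbove j)))
      (Measure.pi fun _ => ρ) (ρ.prod (Measure.pi fun _ => ρ)) :=
  measurePreserving_piFinSuccAbove (fun _ : Fin (n + 1) => ρ) k

theorem integral_pi_succAbove {n : ℕ} (k : Fin (n + 1)) {G : X × (Fin n → X) → ℝ}
    (hG : BddMeas G) :
    ∫ x : Fin (n + 1) → X, G (x k, fun j => x (k.succAbove j)) ∂(Measure.pi fun _ => ρ) =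
      ∫ x, ∫ t, G (t, x) ∂ρ ∂(Measure.pi fun _ => ρ) := by
  have h := measurePreserving_apply_succAbove (ρ := ρ) k
  rw [← integral_prod_symm _ (hG.integrable _), ← h.map_eq,
    integral_map h.measurable.aemeasurable hG.1.aestronglyMeasurable]

theorem integral_pi_cons {n : ℕ} {g : (Fin (n + 1) → X) → ℝ} (hg : BddMeas g) :
    ∫ x, g x ∂(Measure.pi fun _ => ρ) =
      ∫ x, ∫ t, g (Fin.cons t x) ∂ρ ∂(Measure.pi fun _ => ρ) := by
  rw [← integral_pi_succAbove 0
    (hg.comp_measurable (measurable_cons.comp measurable_swap) :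
      BddMeas fun p : X × (Fin n → X) => g (Fin.cons p.1 p.2))]
  refine integral_congr_ae (ae_of_all _ fun x => ?_)
  simp only [Fin.zero_succAbove]
  exact congrArg g (Fin.cons_self_tail x).symm

/-- The average of `g` over the first coordinate. -/
noncomputable def headAverage (ρ : Measure X) {n : ℕ} (g : (Fin (n + 1) → X) → ℝ)
    (x : Fin n → X) : ℝ :=
  ∫ t, g (Fin.cons t x) ∂ρ

variable {n : ℕ} {g : (Fin (n + 1) → X) → ℝ}

theorem BddMeas.uncurry_cons (hg : BddMeas g) :
    BddMeas fun p : (Fin n → X) × X => g (Fin.cons p.2 p.1) :=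
  hg.comp_measurable measurable_cons

theorem BddMeas.cons_left (hg : BddMeas g) (x : Fin n → X) :
    BddMeas fun t => g (Fin.cons t x) :=
  hg.uncurry_cons.comp_measurable (φ := fun t => (x, t)) measurable_prodMk_left

theorem BddMeas.cons_right (hg : BddMeas g) (t : X) : BddMeas fun x => g (Fin.cons t x) :=
  hg.uncurry_cons.comp_measurable (φ := fun x => (x, t)) measurable_prodMk_right

theorem BddMeas.headAverage (hg : BddMeas g) : BddMeas (headAverage ρ g) :=
  hg.uncurry_cons.integral_right ρ

theorem integral_headAverage (hg : BddMeas g) :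
    ∫ x, headAverage ρ g x ∂(Measure.pi fun _ => ρ) = ∫ x, g x ∂(Measure.pi fun _ => ρ) :=
  (integral_pi_cons hg).symm

theorem integral_sub_headAverage (hg : BddMeas g) (x : Fin n → X) :
    ∫ t, (g (Fin.cons t x) - headAverage ρ g x) ∂ρ = 0 := by
  rw [integral_sub ((hg.cons_left x).integrable ρ) (integrable_const _)]
  simp [headAverage]

/-- Sub-Gaussian concentration for functions with bounded differences, in squared form. -/
theorem integral_exp_sq_div_le {c u₀ : ℝ} (hu : 0 < u₀) :
    ∀ {n : ℕ} {g : (Fin n → X) → ℝ}, BddMeas g →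
      (∀ i x t, |g (Function.update x i t) - g x| ≤ c) →
      ∫ x, Real.exp (g x ^ 2 / (u₀ + 8 * c ^ 2 * n)) ∂(Measure.pi fun _ => ρ) ≤
        Real.exp ((∫ x, g x ∂(Measure.pi fun _ => ρ)) ^ 2 / u₀ + n * (c ^ 2 / u₀)) := by
  intro n
  induction n with
  | zero =>
    intro g hg _
    have : g = fun _ => g default := funext fun x => congrArg g (Subsingleton.elim _ _)
    rw [this]
    simp
  | succ n ih =>
    intro g hg hD
    -- Averaging out one coordinate lowers the denominator from `u` to `w = u - 8 * c ^ 2`.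
    set w := u₀ + 8 * c ^ 2 * n with hw
    set u := u₀ + 8 * c ^ 2 * (n + 1 : ℕ) with hu'
    have hwu : u = w + 8 * c ^ 2 := by rw [hu', hw]; push_cast; ring
    have hw0 : u₀ ≤ w := by rw [hw]; nlinarith [mul_nonneg (sq_nonneg c) (Nat.cast_nonneg (α := ℝ) n)]
    have huw : w ≤ u := by rw [hwu]; nlinarith [sq_nonneg c]
    have hw_pos : 0 < w := hu.trans_le hw0
    have hu_pos : 0 < u := hw_pos.trans_le huw
    have hD' : ∀ i x t, |headAverage ρ g (Function.update x i t) - headAverage ρ g x| ≤ c := by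
      intro i x t
      simp only [headAverage]
      rw [← integral_sub ((hg.cons_left _).integrable ρ) ((hg.cons_left _).integrable ρ)]
      refine abs_integral_le fun s => ?_
      rw [Fin.cons_update]
      exact hD i.succ (Fin.cons s x) t
    have hd : ∀ x t, |g (Fin.cons t x) - headAverage ρ g x| ≤ c := by
      intro x t
      have : g (Fin.cons t x) - headAverage ρ g x =
          ∫ s, (g (Fin.cons t x) - g (Fin.cons s x)) ∂ρ := by
        rw [integral_sub (integrable_const _) ((hg.cons_left _).integrable ρ)]
        simp [headAverage]
      rw [this]
      exact abs_integral_le fun s => by simpa using hD 0 (Fin.cons s x) t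
    have hstep : ∀ x, ∫ t, Real.exp (g (Fin.cons t x) ^ 2 / u) ∂ρ ≤
        Real.exp (c ^ 2 / u₀) * Real.exp (headAverage ρ g x ^ 2 / w) := by
      intro x
      set a := headAverage ρ g x with ha
      have hdm : BddMeas fun t => g (Fin.cons t x) - a := (hg.cons_left x).sub (.const a)
      have h1 := integral_exp_mul_le hdm (integral_sub_headAverage hg x) (hd x) (2 * a / u)
      calc ∫ t, Real.exp (g (Fin.cons t x) ^ 2 / u) ∂ρ
          ≤ ∫ t, Real.exp ((a ^ 2 + c ^ 2) / u) *
              Real.exp (2 * a / u * (g (Fin.cons t x) - a)) ∂ρ := by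
            refine integral_mono
              (((hg.cons_left x).continuous_comp (F := fun y => Real.exp (y ^ 2 / u))
                (by fun_prop)).integrable ρ)
              (((hdm.const_mul _).exp.const_mul _).integrable ρ) fun t => ?_
            simp only [← Real.exp_add]
            refine Real.exp_le_exp.2 ?_
            have h2 : (g (Fin.cons t x) - a) ^ 2 ≤ c ^ 2 := by
              rw [← sq_abs (g _ - a)]
              have := hd x t
              gcongr
            -- Expand around `a` and bound the quadratic remainder by `c ^ 2`; what is left is
            -- linear in a centred variable.
            have h3 : g (Fin.cons t x) ^ 2 ≤
              a ^ 2 + c ^ 2 + 2 * a * (g (Fin.cons t x) - a) := by nlinarith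
            calc _ ≤ (a ^ 2 + c ^ 2 + 2 * a * (g (Fin.cons t x) - a)) / u := by gcongr
              _ = _ := by ring
        _ = Real.exp ((a ^ 2 + c ^ 2) / u) *
              ∫ t, Real.exp (2 * a / u * (g (Fin.cons t x) - a)) ∂ρ := integral_const_mul _ _
        _ ≤ Real.exp ((a ^ 2 + c ^ 2) / u) * Real.exp (2 * (2 * a / u) ^ 2 * c ^ 2) := by
            gcongr
        _ ≤ _ := by
            rw [← Real.exp_add, ← Real.exp_add]
            refine Real.exp_le_exp.2 ?_
            have h4 : c ^ 2 / u ≤ c ^ 2 / u₀ := by gcongr; linarith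
            -- The linear part costs `2 * (2 * a / u) ^ 2 * c ^ 2 = 8 * a ^ 2 * c ^ 2 / u ^ 2`. It
            -- is absorbed because `(u + 8c²)(u - 8c²) ≤ u²`, which dictates the increment `8 * c ^
            -- 2`.
            have h5 : 1 / u + 8 * c ^ 2 / u ^ 2 ≤ 1 / w := by
              rw [div_add_div _ _ hu_pos.ne' (by positivity), div_le_div_iff₀ (by positivity) hw_pos]
              have : w = u - 8 * c ^ 2 := by linarith
              rw [this]
              nlinarith [mul_nonneg hu_pos.le (sq_nonneg (c ^ 2))]
            have h6 := mul_le_mul_of_nonneg_left h5 (sq_nonneg a)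
            calc _ = c ^ 2 / u + a ^ 2 * (1 / u + 8 * c ^ 2 / u ^ 2) := by field_simp; ring
              _ ≤ c ^ 2 / u₀ + a ^ 2 * (1 / w) := add_le_add h4 h6
              _ = _ := by ring
    have hexp : BddMeas fun x => Real.exp (g x ^ 2 / u) :=
      hg.continuous_comp (F := fun y => Real.exp (y ^ 2 / u)) (by fun_prop)
    have hexp' : BddMeas fun x => Real.exp (headAverage ρ g x ^ 2 / w) :=
      hg.headAverage.continuous_comp (F := fun y => Real.exp (y ^ 2 / w)) (by fun_prop)
    rw [integral_pi_cons hexp]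
    calc _ ≤ ∫ x, Real.exp (c ^ 2 / u₀) * Real.exp (headAverage ρ g x ^ 2 / w)
          ∂(Measure.pi fun _ => ρ) :=
          integral_mono (hexp.headAverage.integrable _) ((hexp'.const_mul _).integrable _) hstep
      _ = Real.exp (c ^ 2 / u₀) * ∫ x, Real.exp (headAverage ρ g x ^ 2 / w)
          ∂(Measure.pi fun _ => ρ) := integral_const_mul _ _
      _ ≤ Real.exp (c ^ 2 / u₀) * _ := mul_le_mul_of_nonneg_left (ih hg.headAverage hD') (Real.exp_pos _).le
      _ = _ := by
          rw [integral_headAverage hg, ← Real.exp_add]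
          push_cast
          ring_nf

end Product

/-! ### Second-order concentration for degenerate functions. -/

section SecondOrder

variable {X : Type*} [MeasurableSpace X] {ρ : Measure X} [IsProbabilityMeasure ρ]

theorem exp_half_add_half_le (a b : ℝ) :
    Real.exp (a / 2 + b / 2) ≤ Real.exp a / 2 + Real.exp b / 2 := by
  have h := convexOn_exp.2 (Set.mem_univ a) (Set.mem_univ b)
    (show (0 : ℝ) ≤ 1 / 2 by norm_num) (show (0 : ℝ) ≤ 1 / 2 by norm_num) (by norm_num)
  simp only [smul_eq_mul] at h
  have h' : a / 2 + b / 2 = 1 / 2 * a + 1 / 2 * b := by ring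
  rw [h']
  linarith

theorem integral_sub_sub_add {α : Type*} [MeasurableSpace α] {ν : Measure α} [IsFiniteMeasure ν]
    {a b c d : α → ℝ} (ha : BddMeas a) (hb : BddMeas b) (hc : BddMeas c) (hd : BddMeas d) :
    ∫ t, (a t - b t - c t + d t) ∂ν = ∫ t, a t ∂ν - ∫ t, b t ∂ν - ∫ t, c t ∂ν + ∫ t, d t ∂ν := by
  rw [integral_add (((ha.sub hb).sub hc).integrable ν) (hd.integrable ν),
    integral_sub ((ha.sub hb).integrable ν) (hc.integrable ν),
    integral_sub (ha.integrable ν) (hb.integrable ν)]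

/-- Taking `u₀ = 10 * N * c ^ 2` gives `10 + 8 = 18` and leaves the exponent `n / (10 * N) ≤ 1 / 2`.
The scale involves `N` rather than `n` so that it stays fixed while coordinates are averaged out. -/
theorem integral_exp_sq_div_le_two {N n : ℕ} (hN : 0 < N) (hn : n ≤ N) {c : ℝ} (hc : 0 < c)
    {g : (Fin n → X) → ℝ} (hg : BddMeas g) (h0 : ∫ x, g x ∂(Measure.pi fun _ => ρ) = 0)
    (hD : ∀ i x t, |g (Function.update x i t) - g x| ≤ c) :
    ∫ x, Real.exp (g x ^ 2 / (18 * N * c ^ 2)) ∂(Measure.pi fun _ => ρ) ≤ 2 := by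
  have hN' : (0 : ℝ) < N := Nat.cast_pos.2 hN
  have hn' : (n : ℝ) ≤ N := Nat.cast_le.2 hn
  have h := integral_exp_sq_div_le (ρ := ρ) (c := c) (u₀ := 10 * N * c ^ 2) (by positivity) hg hD
  have hle : 10 * N * c ^ 2 + 8 * c ^ 2 * n ≤ 18 * N * c ^ 2 := by nlinarith [sq_nonneg c]
  have hexp : ∀ r : ℝ, BddMeas fun x => Real.exp (g x ^ 2 / r) := fun r =>
    hg.continuous_comp (F := fun y => Real.exp (y ^ 2 / r)) (by fun_prop)
  calc _ ≤ ∫ x, Real.exp (g x ^ 2 / (10 * N * c ^ 2 + 8 * c ^ 2 * n))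
        ∂(Measure.pi fun _ => ρ) :=
        integral_mono ((hexp _).integrable _) ((hexp _).integrable _) fun x => by
          dsimp only
          gcongr
    _ ≤ _ := h
    _ ≤ Real.exp (1 / 2) := by
        rw [h0]
        refine Real.exp_le_exp.2 ?_
        have : (n : ℝ) * (c ^ 2 / (10 * N * c ^ 2)) = n / (10 * N) := by field_simp
        rw [this, zero_pow two_ne_zero, zero_div, zero_add, div_le_div_iff₀ (by positivity) two_pos]
        linarith
    _ ≤ 2 := by
        have h1 : Real.exp (1 / 2) * Real.exp (1 / 2) = Real.exp 1 := by
          rw [← Real.exp_add]; norm_num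
        nlinarith [Real.exp_one_lt_d9, Real.exp_pos (1 / 2)]

/-- Exponential self-normalized bound for a function whose mixed second differences are bounded and
whose conditional expectations given one coordinate vanish. -/
theorem exists_quadratic_variation {N : ℕ} {c : ℝ} (hc : 0 < c) :
    ∀ {n : ℕ}, n ≤ N → ∀ {f : (Fin n → X) → ℝ}, BddMeas f →
      ∫ x, f x ∂(Measure.pi fun _ => ρ) = 0 →
      (∀ j t, ∫ x, f (Function.update x j t) ∂(Measure.pi fun _ => ρ) = 0) →
      (∀ i j x s t, i ≠ j → |f x - f (Function.update x i s) - f (Function.update x j t) +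
        f (Function.update (Function.update x i s) j t)| ≤ c) →
      ∃ v : Fin n → (Fin n → X) → ℝ, (∀ i, BddMeas (v i)) ∧
        (∀ l : ℝ, ∫ x, Real.exp (l * f x - l ^ 2 * ∑ i, v i x) ∂(Measure.pi fun _ => ρ) ≤ 1) ∧
        ∀ i, ∫ x, Real.exp (v i x / (36 * N * c ^ 2)) ∂(Measure.pi fun _ => ρ) ≤ 2 := by
  intro n
  induction n with
  | zero =>
    intro _ f hf h0 _ _
    have hfc : f = fun _ => f default := funext fun x => congrArg f (Subsingleton.elim _ _)
    rw [hfc] at h0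
    have hf0 : f default = 0 := by simpa using h0
    exact ⟨fun i => i.elim0, fun i => i.elim0, fun l => by rw [hfc]; simp [hf0], fun i => i.elim0⟩
  | succ n ih =>
    intro hn f hf h0 h1 hD
    have hN : 0 < N := by omega
    have hN' : (0 : ℝ) < N := Nat.cast_pos.2 hN
    have hcB := fun x : Fin n → X => hf.cons_left x
    have hupd : ∀ (j : Fin (n + 1)) (t : X), Measurable fun x : Fin (n + 1) → X =>
        Function.update x j t := fun j t => measurable_update_left
    obtain ⟨w, hw, hw1, hw2⟩ := ih (by omega) (f := headAverage ρ f) hf.headAverage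
      (by rw [integral_headAverage hf, h0])
      (fun j t => by
        have h := h1 j.succ t
        rw [integral_pi_cons (hf.comp_measurable (hupd _ _))] at h
        simpa only [headAverage, Fin.cons_update] using h)
      (fun i j x s t hij => by
        simp only [headAverage]
        rw [← integral_sub_sub_add (hcB _) (hcB _) (hcB _) (hcB _)]
        refine abs_integral_le fun r => ?_
        simp only [Fin.cons_update]
        exact hD i.succ j.succ (Fin.cons r x) s t (fun h => hij (Fin.succ_injective _ h)))
    set d : (Fin n → X) → X → ℝ := fun x t => f (Fin.cons t x) - headAverage ρ f x with hd
    set e : (Fin n → X) → ℝ := fun x => ∫ t, d x t ^ 2 ∂ρ with he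
    have hdm : BddMeas fun p : (Fin n → X) × X => d p.1 p.2 :=
      hf.uncurry_cons.sub (hf.headAverage.comp_measurable measurable_fst)
    have hdx : ∀ x, BddMeas (d x) := fun x => (hf.cons_left x).sub (.const _)
    have hdt : ∀ t, BddMeas fun x => d x t := fun t => (hf.cons_right t).sub hf.headAverage
    have hem : BddMeas e := hdm.sq.integral_right ρ
    have hd0 : ∀ x, ∫ t, d x t ∂ρ = 0 := integral_sub_headAverage hf
    -- This is where degeneracy enters: with the head frozen at `t`, both `f` and its head average
    -- have mean zero over the tail.
    have hd0' : ∀ t, ∫ x, d x t ∂(Measure.pi fun _ => ρ) = 0 := fun t => by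
      have h := h1 0 t
      rw [integral_pi_cons (hf.comp_measurable (hupd _ _))] at h
      simp only [Fin.update_cons_zero, integral_const, probReal_univ, one_smul] at h
      rw [hd, integral_sub ((hf.cons_right t).integrable _) (hf.headAverage.integrable _), h,
        integral_headAverage hf, h0, sub_zero]
    have hdD : ∀ t i x s, |d (Function.update x i s) t - d x t| ≤ c := by
      intro t i x s
      -- A first difference of `d` in the tail is a mixed difference of `f` in the head and
      -- coordinate `i`, averaged over the head value `r`.
      have : d (Function.update x i s) t - d x t =
          ∫ r, (f (Fin.cons r x) - f (Fin.cons t x) - f (Fin.cons r (Function.update x i s)) +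
            f (Fin.cons t (Function.update x i s))) ∂ρ := by
        rw [integral_sub_sub_add (hcB _) (.const _) (hcB _) (.const _)]
        simp only [hd, headAverage, integral_const, probReal_univ, one_smul]
        ring
      rw [this]
      refine abs_integral_le fun r => ?_
      have h := hD 0 i.succ (Fin.cons r x) t s (Fin.succ_ne_zero i).symm
      rwa [Fin.update_cons_zero, ← Fin.cons_update, ← Fin.cons_update] at h
    have htail : Measurable (Fin.tail : (Fin (n + 1) → X) → Fin n → X) :=
      measurable_pi_lambda _ fun i => measurable_pi_apply i.succ
    set v : Fin (n + 1) → (Fin (n + 1) → X) → ℝ :=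
      Fin.cons (fun y => (f y - headAverage ρ f (Fin.tail y)) ^ 2 + e (Fin.tail y))
        fun i y => w i (Fin.tail y) with hv
    have hv0 : ∀ x t, v 0 (Fin.cons t x) = d x t ^ 2 + e x := fun x t => by simp [hv, hd]
    have hvs : ∀ i x t, v (Fin.succ i) (Fin.cons t x) = w i x := fun i x t => by simp [hv]
    have hvm : ∀ i, BddMeas (v i) := by
      refine Fin.cases ?_ fun i => ?_
      · exact (hf.sub (hf.headAverage.comp_measurable htail)).sq.add (hem.comp_measurable htail)
      · exact (hw i).comp_measurable htail
    refine ⟨v, hvm, fun l => ?_, ?_⟩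
    · have hF : BddMeas fun x => Real.exp (l * f x - l ^ 2 * ∑ i, v i x) :=
        ((hf.const_mul l).sub ((BddMeas.sum _ hvm).const_mul _)).exp
      have hF' : BddMeas fun x => Real.exp (l * headAverage ρ f x - l ^ 2 * ∑ i, w i x) :=
        ((hf.headAverage.const_mul l).sub ((BddMeas.sum _ hw).const_mul _)).exp
      rw [integral_pi_cons hF]
      refine le_trans (integral_mono (hF.headAverage.integrable _) (hF'.integrable _)
        fun x => ?_) (hw1 l)
      have hld := (hdx x).const_mul l
      have hq := integral_exp_sub_sq_le (ν := ρ) hld (by rw [integral_const_mul, hd0, mul_zero])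
      -- Given the tail, everything except `l * d x t - (l * d x t) ^ 2` is constant in `t`; the
      -- term `l ^ 2 * e x` in `v 0` cancels exactly the bound on its exponential moment.
      calc ∫ t, Real.exp (l * f (Fin.cons t x) - l ^ 2 * ∑ i, v i (Fin.cons t x)) ∂ρ
          = ∫ t, Real.exp (l * headAverage ρ f x - l ^ 2 * ∑ i, w i x - l ^ 2 * e x) *
              Real.exp (l * d x t - (l * d x t) ^ 2) ∂ρ := by
            refine integral_congr_ae (ae_of_all _ fun t => ?_)
            simp only [← Real.exp_add, Fin.sum_univ_succ, hv0, hvs]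
            congr 1
            simp only [hd]
            ring
        _ = Real.exp (l * headAverage ρ f x - l ^ 2 * ∑ i, w i x - l ^ 2 * e x) *
              ∫ t, Real.exp (l * d x t - (l * d x t) ^ 2) ∂ρ := integral_const_mul _ _
        _ ≤ Real.exp (l * headAverage ρ f x - l ^ 2 * ∑ i, w i x - l ^ 2 * e x) *
              Real.exp (∫ t, (l * d x t) ^ 2 ∂ρ) :=
            mul_le_mul_of_nonneg_left hq (Real.exp_pos _).le
        _ = _ := by
            simp only [mul_pow, integral_const_mul, ← Real.exp_add, he, sub_add_cancel]
    · have hdiv : ∀ {α : Type _} [MeasurableSpace α] {g : α → ℝ} (r : ℝ), BddMeas g →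
          BddMeas fun x => Real.exp (g x / r) := fun r hg =>
        hg.continuous_comp (F := fun y => Real.exp (y / r)) (by fun_prop)
      refine Fin.cases ?_ fun i => ?_
      · have hE := hdiv (18 * N * c ^ 2) hdm.sq
        have hEx := fun x => hdiv (18 * N * c ^ 2) (hdx x).sq
        rw [integral_pi_cons (hdiv _ (hvm 0))]
        calc _ ≤ ∫ x, ∫ t, Real.exp (d x t ^ 2 / (18 * N * c ^ 2)) ∂ρ
              ∂(Measure.pi fun _ => ρ) := by
              refine integral_mono ((hdiv _ (hvm 0)).headAverage.integrable _)
                ((hE.integral_right ρ).integrable _) fun x => ?_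
              have hJ : Real.exp (e x / (18 * N * c ^ 2)) ≤
                  ∫ t, Real.exp (d x t ^ 2 / (18 * N * c ^ 2)) ∂ρ := by
                rw [he, ← integral_div]
                exact convexOn_exp.map_integral_le Real.continuous_exp.continuousOn isClosed_univ
                  (ae_of_all _ fun _ => Set.mem_univ _) (((hdx x).sq.integrable ρ).div_const _)
                  ((hEx x).integrable ρ)
              calc ∫ t, Real.exp (v 0 (Fin.cons t x) / (36 * N * c ^ 2)) ∂ρ
                  ≤ ∫ t, (1 / 2 * Real.exp (d x t ^ 2 / (18 * N * c ^ 2)) +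
                      1 / 2 * Real.exp (e x / (18 * N * c ^ 2))) ∂ρ := by
                    refine integral_mono ((hdiv _ ((hvm 0).cons_left x)).integrable ρ)
                      ((((hEx x).const_mul _).add (.const _)).integrable ρ) fun t => ?_
                    have h := exp_half_add_half_le (d x t ^ 2 / (18 * N * c ^ 2))
                      (e x / (18 * N * c ^ 2))
                    refine le_trans (le_of_eq (congrArg Real.exp ?_)) (h.trans_eq (by ring))
                    rw [hv0]
                    field_simp
                    ring
                _ = 1 / 2 * (∫ t, Real.exp (d x t ^ 2 / (18 * N * c ^ 2)) ∂ρ) +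
                      1 / 2 * Real.exp (e x / (18 * N * c ^ 2)) := by
                    rw [integral_add (((hEx x).const_mul _).integrable ρ) (integrable_const _),
                      integral_const_mul]
                    simp
                _ ≤ _ := by linarith
          -- Fubini freezes the head `t`, so that the sub-Gaussian bound applies to `d` as a
          -- function of the tail.
          _ = ∫ t, ∫ x, Real.exp (d x t ^ 2 / (18 * N * c ^ 2)) ∂(Measure.pi fun _ => ρ) ∂ρ :=
              integral_integral_swap (hE.integrable _)
          _ ≤ ∫ t, (2 : ℝ) ∂ρ := by
              refine integral_mono
                (((hE.comp_measurable measurable_swap).integral_right _).integrable _)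
                (integrable_const _) fun t => ?_
              exact integral_exp_sq_div_le_two hN (by omega) hc (hdt t) (hd0' t) (hdD t)
          _ = 2 := by simp
      · rw [integral_pi_cons (hdiv _ (hvm i.succ))]
        simpa [hvs] using hw2 i

/-- Second-order concentration: if the mixed second differences of `f` are at most `c` and the
conditional expectations of `f` given any single coordinate vanish, then `f` is sub-exponential at
the scale `n * c`. -/
theorem integral_exp_abs_div_le_two {n : ℕ} (hn : 0 < n) {c : ℝ} (hc : 0 < c)
    {f : (Fin n → X) → ℝ} (hf : BddMeas f) (h0 : ∫ x, f x ∂(Measure.pi fun _ => ρ) = 0)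
    (h1 : ∀ j t, ∫ x, f (Function.update x j t) ∂(Measure.pi fun _ => ρ) = 0)
    (hD : ∀ i j x s t, i ≠ j → |f x - f (Function.update x i s) - f (Function.update x j t) +
        f (Function.update (Function.update x i s) j t)| ≤ c) :
    ∫ x, Real.exp (|f x| / (24 * n * c)) ∂(Measure.pi fun _ => ρ) ≤ 2 := by
  obtain ⟨v, hv, hv1, hv2⟩ := exists_quadratic_variation hc le_rfl hf h0 h1 hD
  have hn' : (0 : ℝ) < n := Nat.cast_pos.2 hn
  -- Chosen so that `(2 * m) ^ 2 = (1 / n) * (1 / (36 * n * c ^ 2))`: Jensen for the uniform average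
  -- over `i` then meets the scale at which each `v i` is controlled.
  set m : ℝ := 1 / (12 * n * c) with hm
  have hE : ∀ l : ℝ, BddMeas fun x => Real.exp (l * f x - l ^ 2 * ∑ i, v i x) := fun l =>
    ((hf.const_mul l).sub ((BddMeas.sum _ hv).const_mul _)).exp
  have hV : ∀ i, BddMeas fun x => Real.exp (v i x / (36 * n * c ^ 2)) := fun i =>
    (hv i).continuous_comp (F := fun y => Real.exp (y / (36 * n * c ^ 2))) (by fun_prop)
  have habs : BddMeas fun x => Real.exp (|f x| / (24 * n * c)) :=
    hf.continuous_comp (F := fun y => Real.exp (|y| / (24 * n * c))) (by fun_prop)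
  have hJ : ∀ x, Real.exp ((2 * m) ^ 2 * ∑ i, v i x) ≤
      ∑ i, 1 / n * Real.exp (v i x / (36 * n * c ^ 2)) := by
    intro x
    have h := convexOn_exp.map_sum_le (t := Finset.univ) (w := fun _ : Fin n => (1 : ℝ) / n)
      (p := fun i => v i x / (36 * n * c ^ 2)) (fun _ _ => by positivity)
      (by simp [hn'.ne']) (fun _ _ => Set.mem_univ _)
    simp only [smul_eq_mul] at h
    refine le_trans (le_of_eq (congrArg Real.exp ?_)) h
    rw [Finset.mul_sum]
    refine Finset.sum_congr rfl fun i _ => ?_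
    rw [hm]
    field_simp
    ring
  set S : (Fin n → X) → ℝ := fun x => ∑ i, 1 / n * Real.exp (v i x / (36 * n * c ^ 2)) with hS
  have hSm : BddMeas S := BddMeas.sum _ fun i => (hV i).const_mul _
  have hS2 : ∫ x, S x ∂(Measure.pi fun _ => ρ) ≤ 2 := by
    rw [hS, integral_finsetSum _ fun i _ => ((hV i).const_mul _).integrable _]
    calc _ ≤ ∑ i : Fin n, 1 / (n : ℝ) * 2 := by
          refine Finset.sum_le_sum fun i _ => ?_
          rw [integral_const_mul]
          exact mul_le_mul_of_nonneg_left (hv2 i) (by positivity)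
      _ = 2 := by simp [hn'.ne']
  -- After integration the right side is at most `1/2 + 1/4 + 1/4 + (1/2) * 2 = 2`. The initial
  -- halving of the exponent `m * |f x|` brings the bound 3 down to 2.
  have hpt : ∀ x, Real.exp (|f x| / (24 * n * c)) ≤ 1 / 2 +
      (1 / 4 * Real.exp (2 * m * f x - (2 * m) ^ 2 * ∑ i, v i x) +
        (1 / 4 * Real.exp (-(2 * m) * f x - (-(2 * m)) ^ 2 * ∑ i, v i x) + 1 / 2 * S x)) := by
    intro x
    have h1 : Real.exp (|f x| / (24 * n * c)) ≤ 1 / 2 + Real.exp (m * |f x|) / 2 := by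
      have h := exp_half_add_half_le 0 (m * |f x|)
      rw [Real.exp_zero] at h
      refine le_trans (le_of_eq (congrArg Real.exp ?_)) h
      rw [hm]
      field_simp
      ring
    have h2 : ∀ l : ℝ, Real.exp (l / 2 * f x) ≤
        Real.exp (l * f x - l ^ 2 * ∑ i, v i x) / 2 + Real.exp (l ^ 2 * ∑ i, v i x) / 2 := by
      intro l
      refine le_trans (le_of_eq (congrArg Real.exp ?_)) (exp_half_add_half_le _ _)
      ring
    have h3 := h2 (2 * m)
    have h4 := h2 (-(2 * m))
    have h5 : Real.exp (m * |f x|) ≤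
        Real.exp (2 * m / 2 * f x) + Real.exp (-(2 * m) / 2 * f x) := by
      rcases abs_cases (f x) with ⟨h, _⟩ | ⟨h, _⟩ <;> rw [h]
      · have : m * f x = 2 * m / 2 * f x := by ring
        rw [this]
        linarith [Real.exp_pos (-(2 * m) / 2 * f x)]
      · have : m * -f x = -(2 * m) / 2 * f x := by ring
        rw [this]
        linarith [Real.exp_pos (2 * m / 2 * f x)]
    have h6 := hJ x
    rw [neg_sq] at h4 ⊢
    simp only [hS]
    linarith
  have hB1 := (hE (2 * m)).const_mul (1 / 4)
  have hB2 := (hE (-(2 * m))).const_mul (1 / 4)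
  have hB3 := hSm.const_mul (1 / 2)
  refine (integral_mono (habs.integrable _)
    (((BddMeas.const _).add (hB1.add (hB2.add hB3))).integrable _) hpt).trans ?_
  rw [integral_add (integrable_const _) ((hB1.add (hB2.add hB3)).integrable _),
    integral_add (hB1.integrable _) ((hB2.add hB3).integrable _),
    integral_add (hB2.integrable _) (hB3.integrable _),
    integral_const_mul, integral_const_mul, integral_const_mul]
  have := hv1 (2 * m)
  have := hv1 (-(2 * m))
  simp only [integral_const, probReal_univ, one_smul]
  linarith

end SecondOrder

/-! ### Mixed differences and degeneracy of the interaction sum. -/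

section Interaction

variable {X : Type*} [MeasurableSpace X] {ρ : Measure X} {n : ℕ}
  {φ : X → (Fin (n + 1) → X) → ℝ}

/-- The sum over all particles of the compensated interaction `φ` with the other particles. -/
noncomputable def interaction (ρ : Measure X) (φ : X → (Fin (n + 1) → X) → ℝ)
    (x : Fin (n + 2) → X) : ℝ :=
  ∑ k, (φ (x k) (k.removeNth x) - ∫ y, φ (x k) y ∂(Measure.pi fun _ => ρ))

theorem measurable_removeNth {n : ℕ} (k : Fin (n + 1)) :
    Measurable fun x : Fin (n + 1) → X => k.removeNth x :=
  measurable_pi_lambda _ fun j => measurable_pi_apply (k.succAbove j)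

theorem abs_interaction_mixed_difference_le {C : ℝ} (hC : 0 ≤ C)
    (h₁ : ∀ z y a s, |φ z y - φ z (Function.update y a s)| ≤ C / (n + 1))
    (h₂ : ∀ z y a b s t, a ≠ b →
      |φ z y - φ z (Function.update y a s) - φ z (Function.update y b t) +
        φ z (Function.update (Function.update y a s) b t)| ≤ C / ((n + 1) * n))
    (i j : Fin (n + 2)) (x : Fin (n + 2) → X) (s t : X) (hij : i ≠ j) :
    |interaction ρ φ x - interaction ρ φ (Function.update x i s) -
        interaction ρ φ (Function.update x j t) +
        interaction ρ φ (Function.update (Function.update x i s) j t)| ≤ 14 * C / (n + 2) := by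
  have hK : 0 ≤ C / ((n + 1) * n) := by positivity
  have hL : 0 ≤ 2 * C / (n + 1) := by positivity
  simp only [interaction]
  rw [← Finset.sum_sub_distrib, ← Finset.sum_sub_distrib, ← Finset.sum_add_distrib]
  refine (Finset.abs_sum_le_sum_abs _ _).trans ?_
  calc _ ≤ ∑ k : Fin (n + 2), ((if k = i then 2 * C / (n + 1) else 0) +
        (if k = j then 2 * C / (n + 1) else 0) + C / ((n + 1) * n)) := by
        refine Finset.sum_le_sum fun k _ => ?_
        rcases eq_or_ne i k with rfl | hik
        -- For `k = i` the compensators cancel, leaving a difference in coordinate `j` at `x i` and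
        -- another at `s`; the case `k = j` is symmetric.
        · obtain ⟨b, rfl⟩ := Fin.exists_succAbove_eq hij.symm
          simp only [if_true, if_neg hij, add_zero, Function.update_self,
            Function.update_of_ne hij, Fin.removeNth_update, Fin.removeNth_update_succAbove]
          refine le_trans ?_ (le_add_of_nonneg_right hK)
          have e1 := h₁ (x i) (i.removeNth x) b t
          have e2 := h₁ s (i.removeNth x) b t
          rw [abs_le] at e1 e2 ⊢
          rw [mul_div_assoc]
          constructor <;> linarith [e1.1, e1.2, e2.1, e2.2]
        rcases eq_or_ne j k with rfl | hjk
        · obtain ⟨a, rfl⟩ := Fin.exists_succAbove_eq hij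
          simp only [if_true, if_neg hij.symm, zero_add, Function.update_self,
            Function.update_of_ne hij.symm, Fin.removeNth_update, Fin.removeNth_update_succAbove]
          refine le_trans ?_ (le_add_of_nonneg_right hK)
          have e1 := h₁ (x j) (j.removeNth x) a s
          have e2 := h₁ t (j.removeNth x) a s
          rw [abs_le] at e1 e2 ⊢
          rw [mul_div_assoc]
          constructor <;> linarith [e1.1, e1.2, e2.1, e2.2]
        · obtain ⟨a, rfl⟩ := Fin.exists_succAbove_eq hik
          obtain ⟨b, rfl⟩ := Fin.exists_succAbove_eq hjk
          have hab : a ≠ b := fun h => hij (h ▸ rfl)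
          simp only [if_neg hik.symm, if_neg hjk.symm, zero_add, Function.update_of_ne hik.symm,
            Function.update_of_ne hjk.symm, Fin.removeNth_update_succAbove]
          refine le_trans (le_of_eq (congrArg _ ?_)) (h₂ (x k) (k.removeNth x) a b s t hab)
          ring
    _ = 4 * C / (n + 1) + (n + 2) * (C / ((n + 1) * n)) := by
        simp only [Finset.sum_add_distrib, Finset.sum_ite_eq', Finset.mem_univ, if_true,
          Finset.sum_const, Finset.card_univ, Fintype.card_fin, nsmul_eq_mul]
        push_cast
        ring
    _ ≤ 4 * C / (n + 1) + 3 * C / (n + 1) := by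
        gcongr
        -- For `n = 0` the quotient by `(n + 1) * n` is zero by convention, consistent with there
        -- being no `k` besides `i` and `j`. For `n ≥ 1`, `n + 2 ≤ 3 * n`.
        rcases Nat.eq_zero_or_pos n with rfl | hn
        · simpa using hC
        · have hn' : (1 : ℝ) ≤ n := by exact_mod_cast hn
          rw [← mul_div_assoc, div_le_div_iff₀ (by positivity) (by positivity)]
          have : 0 ≤ (n + 1 : ℝ) * C * (2 * (n - 1)) := by
            have : (0 : ℝ) ≤ n - 1 := by linarith
            positivity
          linarith
    _ ≤ _ := by
        rw [← add_div, div_le_div_iff₀ (by positivity) (by positivity)]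
        nlinarith [mul_nonneg hC (Nat.cast_nonneg (α := ℝ) n)]

variable [IsProbabilityMeasure ρ]

theorem bddMeas_compensated (hφ : BddMeas fun p : X × (Fin (n + 1) → X) => φ p.1 p.2) :
    BddMeas fun t => ∫ y, φ t y ∂(Measure.pi fun _ => ρ) :=
  hφ.integral_right _

theorem bddMeas_interaction (hφ : BddMeas fun p : X × (Fin (n + 1) → X) => φ p.1 p.2) :
    BddMeas (interaction ρ φ) :=
  BddMeas.sum _ fun k =>
    (hφ.comp_measurable ((measurable_pi_apply k).prodMk (measurable_removeNth k))).sub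
      ((bddMeas_compensated hφ).comp_measurable (measurable_pi_apply k))

theorem integral_apply_removeNth_eq_zero
    (hφ : BddMeas fun p : X × (Fin (n + 1) → X) => φ p.1 p.2)
    (hc : ∀ y, ∫ t, φ t y ∂ρ = 0) (k : Fin (n + 2)) {T : (Fin (n + 1) → X) → Fin (n + 1) → X}
    (hT : Measurable T) :
    ∫ x : Fin (n + 2) → X, φ (x k) (T (k.removeNth x)) ∂(Measure.pi fun _ => ρ) = 0 := by
  refine (integral_pi_succAbove (ρ := ρ) k
    (G := fun p : X × (Fin (n + 1) → X) => φ p.1 (T p.2))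
    (hφ.comp_measurable (measurable_fst.prodMk (hT.comp measurable_snd)))).trans ?_
  simp only [hc, integral_zero]

theorem integral_compensated_apply_eq_zero
    (hφ : BddMeas fun p : X × (Fin (n + 1) → X) => φ p.1 p.2)
    (hc : ∀ y, ∫ t, φ t y ∂ρ = 0) (k : Fin (n + 2)) :
    ∫ x : Fin (n + 2) → X, (∫ y, φ (x k) y ∂(Measure.pi fun _ => ρ)) ∂(Measure.pi fun _ => ρ)
      = 0 := by
  have h := integral_pi_succAbove (ρ := ρ) k
    ((bddMeas_compensated (ρ := ρ) hφ).comp_measurable measurable_fst :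
      BddMeas fun p : X × (Fin (n + 1) → X) => ∫ y, φ p.1 y ∂(Measure.pi fun _ => ρ))
  have h' : ∫ t, ∫ y, φ t y ∂(Measure.pi fun _ => ρ) ∂ρ = 0 := by
    rw [integral_integral_swap (hφ.integrable _)]
    simp [hc]
  simpa only [h', integral_zero] using h

theorem integral_interaction_eq_zero
    (hφ : BddMeas fun p : X × (Fin (n + 1) → X) => φ p.1 p.2) (hc : ∀ y, ∫ t, φ t y ∂ρ = 0) :
    ∫ x, interaction ρ φ x ∂(Measure.pi fun _ => ρ) = 0 := by
  have hA := fun k : Fin (n + 2) =>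
    hφ.comp_measurable ((measurable_pi_apply k).prodMk (measurable_removeNth k))
  have hB := fun k : Fin (n + 2) =>
    (bddMeas_compensated (ρ := ρ) hφ).comp_measurable (measurable_pi_apply (X := fun _ => X) k)
  simp only [interaction]
  rw [integral_finsetSum _ fun k _ => ((hA k).sub (hB k)).integrable _]
  refine Finset.sum_eq_zero fun k _ => ?_
  rw [integral_sub ((hA k).integrable _) ((hB k).integrable _)]
  exact sub_eq_zero.2 ((integral_apply_removeNth_eq_zero hφ hc k measurable_id).trans
    (integral_compensated_apply_eq_zero hφ hc k).symm)

/-- With coordinate `j` frozen, the `j`-th term averages to zero by the choice of the compensator.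
In every other term the particle `x k` is still free, and averaging over it gives zero by centring.
-/
theorem integral_interaction_update_eq_zero
    (hφ : BddMeas fun p : X × (Fin (n + 1) → X) => φ p.1 p.2) (hc : ∀ y, ∫ t, φ t y ∂ρ = 0)
    (j : Fin (n + 2)) (t : X) :
    ∫ x, interaction ρ φ (Function.update x j t) ∂(Measure.pi fun _ => ρ) = 0 := by
  have hU : Measurable fun x : Fin (n + 2) → X => Function.update x j t := measurable_update_left
  have hA := fun k : Fin (n + 2) =>
    (hφ.comp_measurable ((measurable_pi_apply k).prodMk (measurable_removeNth k))).comp_measurable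
      hU
  have hB := fun k : Fin (n + 2) => ((bddMeas_compensated (ρ := ρ) hφ).comp_measurable
    (measurable_pi_apply (X := fun _ => X) k)).comp_measurable hU
  simp only [interaction]
  rw [integral_finsetSum _ fun k _ => ((hA k).sub (hB k)).integrable _]
  refine Finset.sum_eq_zero fun k _ => ?_
  rw [integral_sub ((hA k).integrable _) ((hB k).integrable _)]
  rcases eq_or_ne j k with rfl | hjk
  · have h := integral_pi_succAbove (ρ := ρ) j
      (hφ.comp_measurable (measurable_const.prodMk measurable_snd) :
        BddMeas fun p : X × (Fin (n + 1) → X) => φ t p.2)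
    simp only [integral_const, probReal_univ, one_smul] at h
    simp only [Function.update_self, Fin.removeNth_update, integral_const, probReal_univ, one_smul]
    exact sub_eq_zero.2 h
  · obtain ⟨i, rfl⟩ := Fin.exists_succAbove_eq hjk
    have hk : k ≠ k.succAbove i := (Fin.succAbove_ne k i).symm
    simp only [Function.update_of_ne hk, Fin.removeNth_update_succAbove]
    rw [integral_apply_removeNth_eq_zero hφ hc k (T := fun y => Function.update y i t)
        measurable_update_left, integral_compensated_apply_eq_zero hφ hc k, sub_zero]

end Interaction

/-! ### From conditions on empirical measures to conditions on configurations. -/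

section Empirical

variable {X : Type*} [MeasurableSpace X]

theorem empiricalMeasure_eq_add_dirac {n : ℕ} (y : Fin (n + 1) → X) (a : Fin (n + 1)) :
    empiricalMeasure y = ((n + 1 : ℕ) : ℝ≥0∞)⁻¹ • ∑ k, Measure.dirac (y (a.succAbove k)) +
      ((n + 1 : ℕ) : ℝ≥0∞)⁻¹ • Measure.dirac (y a) := by
  rw [empiricalMeasure, Fin.sum_univ_succAbove _ a, smul_add, add_comm]

theorem empiricalMeasure_eq_add_dirac_add_dirac {n : ℕ} (y : Fin (n + 2) → X) (a : Fin (n + 2))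
    (b : Fin (n + 1)) :
    empiricalMeasure y =
      ((n + 2 : ℕ) : ℝ≥0∞)⁻¹ • ∑ k, Measure.dirac (y (a.succAbove (b.succAbove k))) +
      ((n + 2 : ℕ) : ℝ≥0∞)⁻¹ • (Measure.dirac (y a) + Measure.dirac (y (a.succAbove b))) := by
  rw [empiricalMeasure, Fin.sum_univ_succAbove _ a, Fin.sum_univ_succAbove _ b, ← smul_add]
  congr 1
  abel

variable {ρ : Measure X} {n : ℕ} {C : ℝ} {Φ : X → EmpiricalMeasures (n + 2) X → ℝ}

theorem BoundedDifferences.abs_sub_update_le (h : BoundedDifferences ρ (n + 2) C Φ) (z : X)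
    (y : Fin (n + 1) → X) (a : Fin (n + 1)) (s : X) :
    |Φ z (emp y) - Φ z (emp (N := n + 2) (Function.update y a s))| ≤ C / (n + 1) := by
  have h1 := h.first_order z (y a) s
    (((n + 1 : ℕ) : ℝ≥0∞)⁻¹ • ∑ k, Measure.dirac (y (a.succAbove k)))
    ⟨fun k => y (a.succAbove k), rfl⟩ (emp y) (emp (N := n + 2) (Function.update y a s))
    (empiricalMeasure_eq_add_dirac y a)
    ((empiricalMeasure_eq_add_dirac _ a).trans (by simp [Function.update_of_ne]))
  have e : ((n + 2 : ℕ) : ℝ) - 1 = n + 1 := by push_cast; ring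
  rwa [e] at h1

theorem BoundedDifferences.abs_mixed_difference_le (h : BoundedDifferences ρ (n + 2) C Φ) (z : X)
    (y : Fin (n + 1) → X) (a b : Fin (n + 1)) (s t : X) (hab : a ≠ b) :
    |Φ z (emp y) - Φ z (emp (N := n + 2) (Function.update y a s)) -
        Φ z (emp (N := n + 2) (Function.update y b t)) +
        Φ z (emp (N := n + 2) (Function.update (Function.update y a s) b t))| ≤
      C / ((n + 1) * n) := by
  obtain _ | m := n
  -- For two particles, `Fin 1` has no two distinct indices.
  · exact absurd (Fin.ext (by omega)) hab
  obtain ⟨b, rfl⟩ := Fin.exists_succAbove_eq hab.symm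
  have hne : ∀ k, a.succAbove (b.succAbove k) ≠ a.succAbove b := fun k hk =>
    Fin.succAbove_ne b k (Fin.succAbove_right_injective hk)
  have h2 := h.second_order (by omega) z (y a) s (y (a.succAbove b)) t
    (((m + 2 : ℕ) : ℝ≥0∞)⁻¹ • ∑ k, Measure.dirac (y (a.succAbove (b.succAbove k))))
    ⟨fun k => y (a.succAbove (b.succAbove k)), rfl⟩ (emp y)
    (emp (N := m + 3) (Function.update y a s))
    (emp (N := m + 3) (Function.update y (a.succAbove b) t))
    (emp (N := m + 3) (Function.update (Function.update y a s) (a.succAbove b) t))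
    (empiricalMeasure_eq_add_dirac_add_dirac y a b)
    ((empiricalMeasure_eq_add_dirac_add_dirac _ a b).trans (by simp [Function.update_of_ne]))
    ((empiricalMeasure_eq_add_dirac_add_dirac _ a b).trans
      (by simp [Function.update_of_ne, hne, hab]))
    ((empiricalMeasure_eq_add_dirac_add_dirac _ a b).trans
      (by simp [Function.update_of_ne, hne, hab]))
  have e : ((m + 1 + 2 : ℕ) : ℝ) - 1 = (m + 1 : ℕ) + 1 := by push_cast; ring
  have e' : ((m + 1 + 2 : ℕ) : ℝ) - 2 = (m + 1 : ℕ) := by push_cast; ring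
  rwa [e, e'] at h2

/-- A function with mean zero and oscillation at most `C` is bounded by `C`. This supplies all
integrability, and it forces `Φ = 0` when `C = 0`. -/
theorem BoundedDifferences.abs_le [IsProbabilityMeasure ρ] (h : BoundedDifferences ρ (n + 2) C Φ)
    (hm : Measurable fun p : X × (Fin (n + 1) → X) => Φ p.1 (emp p.2)) (z : X)
    (y : Fin (n + 1) → X) : |Φ z (emp y)| ≤ C := by
  have hy : BddMeas fun t => Φ t (emp y) := by
    refine ⟨hm.comp measurable_prodMk_right, C + |Φ z (emp y)|, fun t => ?_⟩
    have h1 := abs_add_le (Φ t (emp y) - Φ z (emp y)) (Φ z (emp y))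
    rw [sub_add_cancel] at h1
    exact h1.trans (by gcongr; exact h.bounded_fst _ _ _)
  have h2 : Φ z (emp y) = ∫ t, (Φ z (emp y) - Φ t (emp y)) ∂ρ := by
    rw [integral_sub (integrable_const _) (hy.integrable ρ), h.centered]
    simp
  rw [h2]
  exact abs_integral_le fun t => h.bounded_fst _ _ _

end Empirical

end MeanField

/-! ### The main theorem. -/

theorem lemma4p5 :
    ∃ b : ℝ, 0 < b ∧
      ∀ (X : Type u) [MeasurableSpace X] (ρ : Measure X) [IsProbabilityMeasure ρ]
        (N : ℕ) (_ : 2 ≤ N) (C : ℝ) (_ : 0 ≤ C)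
        (Φ : X → MeanField.EmpiricalMeasures N X → ℝ)
        (_ : Measurable fun p : X × (Fin (N - 1) → X) => Φ p.1 (MeanField.emp p.2))
        (_ : MeanField.BoundedDifferences ρ N C Φ),
        (0 < C →
          Integrable (fun x : Fin N → X => Real.exp (b / C * |MeanField.fluctuation ρ Φ x|))
              (Measure.pi fun _ => ρ) ∧
            ∫ x : Fin N → X, Real.exp (b / C * |MeanField.fluctuation ρ Φ x|)
              ∂(Measure.pi fun _ => ρ) ≤ 2) ∧
        (C = 0 → ∀ x : Fin N → X, MeanField.fluctuation ρ Φ x = 0) := by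
  -- `336 = 24 * 14`: the factor 24 is from second-order concentration, and 14 is from the mixed
  -- differences, whose denominator `n + 2` cancels the number of particles.
  refine ⟨1 / 336, by norm_num, fun X _ ρ _ N hN C hC Φ hm h => ?_⟩
  obtain ⟨n, rfl⟩ := Nat.exists_eq_add_of_le' hN
  have hbd := h.abs_le hm
  have hφ : MeanField.BddMeas fun p : X × (Fin (n + 1) → X) => Φ p.1 (MeanField.emp p.2) :=
    ⟨hm, C, fun p => hbd p.1 p.2⟩
  have hF : MeanField.fluctuation ρ Φ =
      MeanField.interaction ρ fun z (y : Fin (n + 1) → X) => Φ z (MeanField.emp y) := rfl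
  refine ⟨fun hC0 => ?_, ?_⟩
  · rw [hF]
    have hFm := MeanField.bddMeas_interaction (ρ := ρ)
      (φ := fun z (y : Fin (n + 1) → X) => Φ z (MeanField.emp y)) hφ
    refine ⟨(hFm.continuous_comp (F := fun y => Real.exp (1 / 336 / C * |y|))
      (by fun_prop)).integrable _, ?_⟩
    have hmain := MeanField.integral_exp_abs_div_le_two (ρ := ρ) (c := 14 * C / (n + 2))
      (Nat.succ_pos (n + 1)) (by positivity) hFm
      (MeanField.integral_interaction_eq_zero hφ fun y => h.centered _)
      (MeanField.integral_interaction_update_eq_zero hφ fun y => h.centered _)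
      (MeanField.abs_interaction_mixed_difference_le hC h.abs_sub_update_le
        h.abs_mixed_difference_le)
    have hscale : ∀ r : ℝ, r / (24 * ((n + 1).succ : ℕ) * (14 * C / (n + 2))) =
        1 / 336 / C * r := by
      intro r
      push_cast
      field_simp
      ring
    simpa only [hscale] using hmain
  · rintro rfl x
    have h0 : ∀ z (y : Fin (n + 1) → X), Φ z (MeanField.emp y) = 0 := fun z y =>
      abs_nonpos_iff.1 (hbd z y)
    rw [hF]
    simp [MeanField.interaction, h0]
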